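/- Let $K$ be a field of characteristic $0$ with an automorphism $\sigma$ such that $\sigma^2=\mathrm{id}$ (for example $\sigma=\mathrm{id}$, or complex conjugation on $\mathbb C$). By a triple product on a $K$-vector space $T$ we mean a map $(a,b,c)\mapsto(abc)\in T$ that is additive in each argument, $K$-linear in $a$ and $c$, and $\sigma$-semilinear in $b$. The space $T$ is a *generalized Jordan triple system* if $$(ab(xyz))-(xy(abz))=((abx)yz)-(x(bay)z)\qquad\text{for all }a,b,x,y,z\in T,$$ and $T$ is *K-simple* if there is no subspace $U$ with $0\ne U\neq T$, $(TTU)\subseteq U$ and $(UTT)\subseteq U$. The *graded Lie algebra $g=\bigoplus_{k\in\mathbb Z}g_k$ associated to $T$* is constructed as follows. Let $\tilde g$ be the $K$-Lie algebra generated by symbols $a$ and $\tau(a)$, $a\in T$, subject to the relations that $a\mapsto a$ is $K$-linear, $a\mapsto\tau(a)$ is $\sigma$-semilinear, and $$[[a,\tau(b)],c]=(abc),\qquad [[\tau(a),b],\tau(c)]=\tau\big((abc)\big).$$ It is graded, with $a$ at level $1$ and $\tau(a)$ at level $-1$. Then $g$ is the quotient of $\tilde g$ by its largest graded ideal that meets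 $\tilde g_1$ and $\tilde g_{-1}$ only in $0$. **Corollary.** (i) Let $T$ be a generalized Jordan triple system that is K-simple, whose triple product is not identically zero, and is antisymmetric in its first and third arguments, i.e. $(abc)=-(cba)$ for all $a,b,c\in T$. Then the associated graded Lie algebra $g$ is infinite-dimensional. (ii) In particular, let $T=K^4$ with standard basis $e_1,\dots,e_4$ and $(e_ie_je_k)=\lambda\sum_{l}\varepsilon_{ijkl}\,e_l$, where $\varepsilon$ is the totally antisymmetric tensor with $\varepsilon_{1234}=1$ and $\lambda\in K$ satisfies $\lambda\neq0$ and $\sigma(\lambda)=\lambda$. Then $T$ is a K-simple generalized Jordan triple system that is antisymmetric in the first and third arguments, and its associated graded Lie algebra is infinite-dimensional. -/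

import Mathlib

/-! Triple products on a vector space `T` over a field `K`.  They are linear in the first and third
arguments and `σ`-semilinear in the second one, where `σ` is an involution of `K`
(`σ = id`: trilinear products; complex conjugation: products antilinear in the middle). -/

/-- The defining identity of a generalized Jordan triple system:
`(a b (x y z)) - (x y (a b z)) = ((a b x) y z) - (x (b a y) z)`. -/
def IsGeneralizedJordan {K T : Type*} [Field K] [AddCommGroup T] [Module K T] {σ : K →+* K}
    (p : T →ₗ[K] T →ₛₗ[σ] T →ₗ[K] T) : Prop :=
  ∀ a b x y z : T, p a b (p x y z) - p x y (p a b z) = p (p a b x) y z - p x (p b a y) z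

/-- K-simplicity: there is no proper non-trivial subspace `U` with `(TTU) ⊆ U` and `(UTT) ⊆ U`. -/
def IsKSimple {K T : Type*} [Field K] [AddCommGroup T] [Module K T] {σ : K →+* K}
    (p : T →ₗ[K] T →ₛₗ[σ] T →ₗ[K] T) : Prop :=
  ∀ U : Submodule K T, (∀ u ∈ U, ∀ a b : T, p a b u ∈ U) → (∀ u ∈ U, ∀ a b : T, p u a b ∈ U) →
    U = ⊥ ∨ U = ⊤

/-- Antisymmetry in the first and third arguments. -/
def IsAntisymmFirstThird {K T : Type*} [Field K] [AddCommGroup T] [Module K T] {σ : K →+* K}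
    (p : T →ₗ[K] T →ₛₗ[σ] T →ₗ[K] T) : Prop :=
  ∀ a b c : T, p a b c = -p c b a

namespace Kantor

/-- The free Lie algebra on the disjoint union of two copies of `T`; the first copy will become
level `1`, the second one level `-1`. -/
abbrev Free (K T : Type*) [Field K] : Type _ := FreeLieAlgebra K (T ⊕ T)

/-- The generator `a` at level `1`. -/
noncomputable def pos (K : Type*) {T : Type*} [Field K] (a : T) : Free K T := FreeLieAlgebra.of K (Sum.inl a)

/-- The generator `τ(a)` at level `-1`. -/
noncomputable def neg (K : Type*) {T : Type*} [Field K] (a : T) : Free K T := FreeLieAlgebra.of K (Sum.inr a)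

variable {K T : Type*} [Field K] [AddCommGroup T] [Module K T] {σ : K →+* K}

/-- The relations imposed on the free Lie algebra: `a ↦ a` is linear, `a ↦ τ(a)` is `σ`-semilinear,
`[[a, τ(b)], c] = (abc)` and `[[τ(a), b], τ(c)] = τ((abc))`. -/
inductive Relator (p : T →ₗ[K] T →ₛₗ[σ] T →ₗ[K] T) : Free K T → Prop
  | pos_add (a b : T) : Relator p (pos K (a + b) - (pos K a + pos K b))
  | pos_smul (k : K) (a : T) : Relator p (pos K (k • a) - k • pos K a)
  | neg_add (a b : T) : Relator p (neg K (a + b) - (neg K a + neg K b))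
  | neg_smul (k : K) (a : T) : Relator p (neg K (k • a) - σ k • neg K a)
  | triple_pos (a b c : T) : Relator p (⁅⁅pos K a, neg K b⁆, pos K c⁆ - pos K (p a b c))
  | triple_neg (a b c : T) : Relator p (⁅⁅neg K a, pos K b⁆, neg K c⁆ - neg K (p a b c))

/-- The ideal of the free Lie algebra generated by the relations. -/
noncomputable def relatorIdeal (p : T →ₗ[K] T →ₛₗ[σ] T →ₗ[K] T) : LieIdeal K (Free K T) :=
  LieSubmodule.lieSpan K (Free K T) {x | Relator p x}

/-- The largest Lie algebra generated by `T` and `τ(T)` subject to the relations above. -/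
abbrev Universal (p : T →ₗ[K] T →ₛₗ[σ] T →ₗ[K] T) : Type _ := Free K T ⧸ relatorIdeal p

/-- The projection of the free Lie algebra onto the universal one. -/
noncomputable def toUniversal (p : T →ₗ[K] T →ₛₗ[σ] T →ₗ[K] T) (x : Free K T) : Universal p :=
  LieSubmodule.Quotient.mk x

/-- Iterated brackets of generators, with their degree: the number of generators from `T` minus the
number of generators from `τ(T)`. -/
inductive IsMonomial (p : T →ₗ[K] T →ₛₗ[σ] T →ₗ[K] T) : ℤ → Universal p → Prop
  | pos (a : T) : IsMonomial p 1 (toUniversal p (pos K a))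
  | neg (a : T) : IsMonomial p (-1) (toUniversal p (neg K a))
  | bracket {i j : ℤ} {x y : Universal p} :
      IsMonomial p i x → IsMonomial p j y → IsMonomial p (i + j) ⁅x, y⁆

/-- The subspace of level `k` of the universal Lie algebra. -/
noncomputable def level (p : T →ₗ[K] T →ₛₗ[σ] T →ₗ[K] T) (k : ℤ) : Submodule K (Universal p) :=
  Submodule.span K {x | IsMonomial p k x}

/-- An ideal is graded if it is the sum of its intersections with the levels. -/
def IsGradedIdeal (p : T →ₗ[K] T →ₛₗ[σ] T →ₗ[K] T) (I : LieIdeal K (Universal p)) : Prop :=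
  I.toSubmodule = ⨆ k : ℤ, I.toSubmodule ⊓ level p k

/-- The largest graded ideal that meets the levels `1` and `-1` trivially, as the sum of all of
them.  At level `0` it consists of the elements that act trivially on the levels `1` and `-1`, so
that level `0` of the quotient is a Lie algebra of operators on the levels `1` and `-1`. -/
noncomputable def maxIdeal (p : T →ₗ[K] T →ₛₗ[σ] T →ₗ[K] T) : LieIdeal K (Universal p) :=
  sSup {I | IsGradedIdeal p I ∧ I.toSubmodule ⊓ level p 1 = ⊥ ∧ I.toSubmodule ⊓ level p (-1) = ⊥}

/-- The graded Lie algebra associated to a generalized Jordan triple system: it is generated by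
level `1`, a copy of `T`, and level `-1`, a copy of `τ(T)`, with `(abc) = [[a, τ(b)], c]`,
and it has no nonzero graded ideal that meets the levels `1` and `-1` trivially. -/
abbrev LieAlg (p : T →ₗ[K] T →ₛₗ[σ] T →ₗ[K] T) : Type _ := Universal p ⧸ maxIdeal p

end Kantor

/-- The `so(4)` epsilon tensor: `ε₀₁₂₃ = 1`, totally antisymmetric. -/
def epsilonTensor (i j k l : Fin 4) : ℤ :=
  Matrix.det (Matrix.of fun r s : Fin 4 => if ![i, j, k, l] r = s then (1 : ℤ) else 0)

/-- The triple product on `K⁴` whose structure constants are `c` times the epsilon tensor: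
`(e_i e_j e_k) = c ∑ l, ε_{ijkl} e_l`. -/
noncomputable def blgProduct {K : Type*} [Field K] (σ : K →+* K) (c : K) :
    (Fin 4 → K) →ₗ[K] (Fin 4 → K) →ₛₗ[σ] (Fin 4 → K) →ₗ[K] (Fin 4 → K) where
  toFun x :=
    { toFun := fun y =>
        { toFun := fun z l =>
            ∑ i, ∑ j, ∑ k, c * (epsilonTensor i j k l : K) * x i * σ (y j) * z k
          map_add' := fun z z' => by
            funext l
            simp only [Pi.add_apply, mul_add, Finset.sum_add_distrib]
          map_smul' := fun r z => by
            funext l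
            simp only [Pi.smul_apply, smul_eq_mul, RingHom.id_apply, Finset.mul_sum]
            refine Finset.sum_congr rfl fun i _ => Finset.sum_congr rfl fun j _ =>
              Finset.sum_congr rfl fun k _ => ?_
            ring }
      map_add' := fun y y' => by
        refine LinearMap.ext fun z => ?_
        funext l
        simp only [LinearMap.coe_mk, AddHom.coe_mk, LinearMap.add_apply, Pi.add_apply, map_add,
          mul_add, add_mul, Finset.sum_add_distrib]
      map_smul' := fun r y => by
        refine LinearMap.ext fun z => ?_
        funext l
        simp only [LinearMap.coe_mk, AddHom.coe_mk, LinearMap.smul_apply, Pi.smul_apply,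
          smul_eq_mul, map_mul, Finset.mul_sum]
        refine Finset.sum_congr rfl fun i _ => Finset.sum_congr rfl fun j _ =>
          Finset.sum_congr rfl fun k _ => ?_
        ring }
  map_add' x x' := by
    refine LinearMap.ext fun y => LinearMap.ext fun z => ?_
    funext l
    simp only [LinearMap.coe_mk, AddHom.coe_mk, LinearMap.add_apply, Pi.add_apply,
      mul_add, add_mul, Finset.sum_add_distrib]
  map_smul' r x := by
    refine LinearMap.ext fun y => LinearMap.ext fun z => ?_
    funext l
    simp only [LinearMap.coe_mk, AddHom.coe_mk, LinearMap.smul_apply, Pi.smul_apply,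
      smul_eq_mul, RingHom.id_apply, Finset.mul_sum]
    refine Finset.sum_congr rfl fun i _ => Finset.sum_congr rfl fun j _ =>
      Finset.sum_congr rfl fun k _ => ?_
    ring

/-! Suppose `g` is finite-dimensional. Antisymmetry gives `[[x, y], x] = 0` for `x = a`, `y = τ(b)`,
so `ad [x, y]` is nilpotent by Jacobson's lemma (`isNilpotent_of_commute_commutator`). Its trace on
each level then vanishes; hence the trace of `ad y ad x` on a level does not depend on the level,
and it is zero far out. So the Killing form vanishes on `(x, y)`. The code replaces levelwise traces
by traces against powers of the automorphism `scale`, which multiplies level `k` by `2 ^ k`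
(`trace_mul_eq_zero_of_isNilpotent_commutator`). Invariance under this automorphism makes level `1`
orthogonal to every level except `-1`, and level `-1` is spanned by the `τ(b)` (`level_neg_one_le`).
Thus level `1` lies in the kernel of the Killing form, which is solvable by Cartan's criterion.

K-simplicity and a nonzero product force `T` to be spanned by the products `(abc) = [[a, τ(b)], c]`,
so level `1` survives in every derived ideal of the radical and must be zero. But level `1` is a
faithful copy of `T` (`toLieAlg_posHom_injective`): the universal algebra acts on the tensor algebra
of `T` with `a` acting as left multiplication, and the sum of the ideals divided out still misses
level `1`. -/

/-! ### Traces and nilpotency of endomorphisms -/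

section Trace

open Polynomial

variable {K V : Type*} [Field K] [AddCommGroup V] [Module K V] [FiniteDimensional K V]

/-- An endomorphism all of whose multiples by polynomials in itself without constant term have
trace zero is nilpotent. -/
theorem isNilpotent_of_forall_trace_mul_aeval_eq_zero [CharZero K] (h : Module.End K V)
    (H : ∀ q : K[X], LinearMap.trace K V (h * aeval h q) = 0) : IsNilpotent h := by
  -- The extra factor `X` makes the exponent of `X` positive even if `h` is invertible; the
  -- idempotent below is then a multiple of `h`.
  have hne : X * minpoly K h ≠ 0 :=
    mul_ne_zero X_ne_zero (minpoly.ne_zero (Algebra.IsIntegral.isIntegral h))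
  obtain ⟨r, hr, hr'⟩ := exists_eq_pow_rootMultiplicity_mul_and_not_dvd (X * minpoly K h) hne 0
  have hm : 0 < rootMultiplicity 0 (X * minpoly K h) := by
    rw [rootMultiplicity_pos hne]; simp
  obtain ⟨m, hm⟩ := Nat.exists_eq_succ_of_ne_zero hm.ne'
  rw [hm] at hr
  simp only [C_0, sub_zero] at hr hr'
  have hz : aeval h (X ^ (m + 1) * r) = 0 := by
    have : aeval h (X * minpoly K h) = 0 := by simp
    rwa [hr] at this
  have hcop : IsCoprime (X ^ (m + 1)) r :=
    ((irreducible_X (R := K)).coprime_iff_not_dvd.mpr hr').pow_left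
  obtain ⟨u, v, huv⟩ := hcop
  -- This is the Fitting projection onto the part where `h` is invertible. Its trace is zero, so in
  -- characteristic zero it vanishes.
  have hidem : IsIdempotentElem (aeval h (u * X ^ (m + 1))) := by
    have h1 : u * X ^ (m + 1) * (u * X ^ (m + 1)) =
        u * X ^ (m + 1) - u * v * (X ^ (m + 1) * r) := by
      linear_combination (u * X ^ (m + 1)) * huv
    rw [IsIdempotentElem, ← map_mul, h1, map_sub, map_mul _ (u * v), hz, mul_zero, sub_zero]
  have he : aeval h (u * X ^ (m + 1)) = 0 := by
    apply LinearMap.IsIdempotentElem.eq_zero_of_trace_eq_zero hidem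
    have h1 : aeval h (u * X ^ (m + 1)) = h * aeval h (u * X ^ m) := by
      rw [show u * X ^ (m + 1) = X * (u * X ^ m) by ring, map_mul, aeval_X]
    rw [h1, H]
  refine ⟨m + 1, ?_⟩
  have h2 : (X : K[X]) ^ (m + 1) = X ^ (m + 1) * (u * X ^ (m + 1)) + v * (X ^ (m + 1) * r) := by
    linear_combination -(X ^ (m + 1)) * huv
  have h3 := congrArg (aeval h) h2
  rw [map_add, map_mul _ (X ^ (m + 1)), map_mul _ v, he, hz, mul_zero, mul_zero, add_zero] at h3
  simpa using h3

/-- Jacobson's lemma: a commutator that commutes with one of its arguments is nilpotent. -/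
theorem isNilpotent_of_commute_commutator [CharZero K] {A B : Module.End K V}
    (h : Commute (A * B - B * A) A) : IsNilpotent (A * B - B * A) := by
  refine isNilpotent_of_forall_trace_mul_aeval_eq_zero _ fun q => ?_
  -- Since `Q` commutes with `A`, the product `(AB - BA)Q` is the commutator of `A` and `BQ`, hence
  -- traceless.
  have hc : Commute (aeval (A * B - B * A) q) A :=
    Algebra.commute_of_mem_adjoin_singleton_of_commute (aeval_mem_adjoin_singleton K _) h.symm |>.symm
  set Q := aeval (A * B - B * A) q
  rw [sub_mul, map_sub, mul_assoc, LinearMap.trace_mul_comm, mul_assoc B A Q, ← hc.eq, ← mul_assoc,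
    sub_self]

/-- Zero is not an eigenvalue, so the minimal polynomial has a nonzero constant term to divide by.
This recovers the plain trace from traces against positive powers of `S`. -/
theorem exists_aeval_mul_self_eq_one {S : Module.End K V} (hS : Function.Injective S) :
    ∃ q : K[X], aeval S q * S = 1 := by
  have h0 : (minpoly K S).coeff 0 ≠ 0 := fun h => by
    rw [coeff_zero_eq_eval_zero] at h
    obtain ⟨v, hv⟩ := (Module.End.hasEigenvalue_iff_isRoot.mpr h).exists_hasEigenvector
    refine hv.2 (hS ?_)
    rw [hv.apply_eq_smul, zero_smul, map_zero]
  have h1 := congrArg (aeval S) (divX_mul_X_add (minpoly K S))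
  rw [minpoly.aeval, map_add, map_mul, aeval_X, aeval_C, Algebra.algebraMap_eq_smul_one] at h1
  refine ⟨-(C ((minpoly K S).coeff 0)⁻¹ * (minpoly K S).divX), ?_⟩
  rw [map_neg, map_mul, aeval_C, ← Algebra.smul_def, neg_mul, smul_mul_assoc,
    eq_neg_of_add_eq_zero_left h1, smul_neg, neg_neg, smul_smul, inv_mul_cancel₀ h0, one_smul]

/-- If `A` is homogeneous for the grading given by `S`, then the trace of `B * A` vanishes as soon
as the commutator of `A` and `B` is nilpotent and of degree zero. -/
theorem trace_mul_eq_zero_of_isNilpotent_commutator {A B S : Module.End K V} {c : K}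
    (hc : ∀ n : ℕ, c ^ (n + 1) ≠ 1) (hS : Function.Injective S) (hSA : S * A = c • (A * S))
    (hSh : Commute S (A * B - B * A)) (hn : IsNilpotent (A * B - B * A)) :
    LinearMap.trace K V (B * A) = 0 := by
  have hpow : ∀ n : ℕ, S ^ n * A = c ^ n • (A * S ^ n) := fun n => by
    induction n with
    | zero => simp
    | succ n ih =>
      rw [pow_succ, mul_assoc, hSA, mul_smul_comm, ← mul_assoc, ih, smul_mul_assoc, smul_smul,
        mul_assoc, pow_succ' c]
  -- Moving `A` past `S ^ (n + 1)` and cyclically around the trace turns the trace of `S ^ (n + 1) *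
  -- (A * B - B * A)` into `c ^ (n + 1) - 1` times the wanted one.
  have h1 : ∀ n : ℕ, LinearMap.trace K V (S ^ (n + 1) * (B * A)) = 0 := fun n => by
    have h2 : LinearMap.trace K V (S ^ (n + 1) * (A * B - B * A)) = 0 :=
      (LinearMap.isNilpotent_trace_of_isNilpotent
        ((hSh.pow_left (n + 1)).isNilpotent_mul_left hn)).eq_zero
    rw [mul_sub, map_sub, ← mul_assoc, hpow, smul_mul_assoc, map_smul, mul_assoc,
      LinearMap.trace_mul_comm, mul_assoc, smul_eq_mul, ← sub_one_mul] at h2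
    exact (mul_eq_zero.mp h2).resolve_left (sub_ne_zero.mpr (hc n))
  have h2 : ∀ q : K[X], LinearMap.trace K V (aeval S q * S * (B * A)) = 0 := fun q => by
    induction q using Polynomial.induction_on' with
    | add q r hq hr => rw [map_add, add_mul, add_mul, map_add, hq, hr, add_zero]
    | monomial n a =>
      rw [aeval_monomial, ← Algebra.smul_def, smul_mul_assoc, smul_mul_assoc, map_smul,
        ← pow_succ, h1, smul_zero]
  obtain ⟨q, hq⟩ := exists_aeval_mul_self_eq_one hS
  simpa [hq] using h2 q

end Trace

/-! ### Triangular decomposition from the triple relations -/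

namespace LieAlgebra

variable {K L : Type*} [CommRing K] [LieRing L] [LieAlgebra K L]

/-- The span of the brackets of elements of two submodules. -/
def bracketSpan (A B : Submodule K L) : Submodule K L :=
  Submodule.span K {z | ∃ a ∈ A, ∃ b ∈ B, ⁅a, b⁆ = z}

theorem lie_mem_bracketSpan {A B : Submodule K L} {a b : L} (ha : a ∈ A) (hb : b ∈ B) :
    ⁅a, b⁆ ∈ bracketSpan A B :=
  Submodule.subset_span ⟨a, ha, b, hb, rfl⟩

theorem bracketSpan_comm (A B : Submodule K L) : bracketSpan A B = bracketSpan B A := by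
  have key : ∀ A B : Submodule K L, bracketSpan A B ≤ bracketSpan B A := fun A B => by
    refine Submodule.span_le.mpr ?_
    rintro _ ⟨a, ha, b, hb, rfl⟩
    rw [← lie_skew]
    exact neg_mem (lie_mem_bracketSpan hb ha)
  exact le_antisymm (key A B) (key B A)

/-- To see that `x` maps the span of brackets into a submodule, it is enough to look at brackets. -/
theorem lie_mem_of_mem_bracketSpan {A B N : Submodule K L} {x z : L}
    (h : ∀ a ∈ A, ∀ b ∈ B, ⁅x, ⁅a, b⁆⁆ ∈ N) (hz : z ∈ bracketSpan A B) : ⁅x, z⁆ ∈ N := by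
  have : bracketSpan A B ≤ N.comap (ad K L x : L →ₗ[K] L) := by
    refine Submodule.span_le.mpr ?_
    rintro _ ⟨a, ha, b, hb, rfl⟩
    exact h a ha b hb
  exact this hz

/-- The span of the right-normed brackets of length `n + 1` of elements of `A`. -/
def bracketChain (A : Submodule K L) : ℕ → Submodule K L
  | 0 => A
  | n + 1 => bracketSpan A (bracketChain A n)

/-- The pieces of the triangular decomposition of the Lie algebra generated by `A` (in degree `1`)
and `B` (in degree `-1`). -/
def triangularPart (A B : Submodule K L) : ℤ → Submodule K L
  | .ofNat 0 => bracketSpan A B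
  | .ofNat (n + 1) => bracketChain A n
  | .negSucc n => bracketChain B n

variable {A B : Submodule K L}

theorem lie_mem_bracketChain_of_stable {h : L} (hA : ∀ a ∈ A, ⁅h, a⁆ ∈ A) {n : ℕ} {x : L}
    (hx : x ∈ bracketChain A n) : ⁅h, x⁆ ∈ bracketChain A n := by
  induction n generalizing x with
  | zero => exact hA x hx
  | succ n ih =>
    refine lie_mem_of_mem_bracketSpan (fun a ha y hy => ?_) hx
    rw [leibniz_lie]
    exact add_mem (lie_mem_bracketSpan (hA a ha) hy) (lie_mem_bracketSpan ha (ih hy))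

theorem lie_mem_of_mem_bracketSpan_left
    (hAB : ∀ a ∈ A, ∀ b ∈ B, ∀ c ∈ A, ⁅⁅a, b⁆, c⁆ ∈ A) {h c : L}
    (hh : h ∈ bracketSpan A B) (hc : c ∈ A) : ⁅h, c⁆ ∈ A := by
  rw [← lie_skew]
  refine neg_mem (lie_mem_of_mem_bracketSpan (fun a ha b hb => ?_) hh)
  rw [← lie_skew]
  exact neg_mem (hAB a ha b hb c hc)

theorem lie_mem_bracketChain_pred
    (hAB : ∀ a ∈ A, ∀ b ∈ B, ∀ c ∈ A, ⁅⁅a, b⁆, c⁆ ∈ A) {b x : L} (hb : b ∈ B) {n : ℕ}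
    (hx : x ∈ bracketChain A (n + 1)) : ⁅b, x⁆ ∈ bracketChain A n := by
  induction n generalizing x with
  | zero =>
    refine lie_mem_of_mem_bracketSpan (fun a ha y hy => ?_) hx
    -- Here `[b, y]` has degree `0` and is in no chain, so both terms are written as triple
    -- brackets.
    have h1 : ⁅b, ⁅a, y⁆⁆ = -⁅⁅a, b⁆, y⁆ + ⁅⁅y, b⁆, a⁆ := by
      rw [leibniz_lie, ← lie_skew b a, neg_lie, ← lie_skew a ⁅b, y⁆, ← lie_skew b y, neg_lie,
        neg_neg]
    rw [h1]
    exact add_mem (neg_mem (hAB a ha b hb y hy)) (hAB y hy b hb a ha)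
  | succ n ih =>
    refine lie_mem_of_mem_bracketSpan (fun a ha y hy => ?_) hx
    rw [leibniz_lie, ← lie_skew b a, neg_lie]
    exact add_mem (neg_mem (lie_mem_bracketChain_of_stable (hAB a ha b hb) hy))
      (lie_mem_bracketSpan ha (ih hy))

theorem lie_mem_triangularPart_add_one
    (hAB : ∀ a ∈ A, ∀ b ∈ B, ∀ c ∈ A, ⁅⁅a, b⁆, c⁆ ∈ A)
    (hBA : ∀ b ∈ B, ∀ a ∈ A, ∀ c ∈ B, ⁅⁅b, a⁆, c⁆ ∈ B) {a x : L} (ha : a ∈ A) :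
    ∀ k : ℤ, x ∈ triangularPart A B k → ⁅a, x⁆ ∈ triangularPart A B (k + 1)
  | .ofNat 0, hx => by
    rw [← lie_skew]
    exact neg_mem (lie_mem_of_mem_bracketSpan_left hAB hx ha)
  | .ofNat (n + 1), hx => (lie_mem_bracketSpan ha hx : ⁅a, x⁆ ∈ bracketChain A (n + 1))
  | .negSucc 0, hx => (lie_mem_bracketSpan ha hx : ⁅a, x⁆ ∈ bracketSpan A B)
  | .negSucc (n + 1), hx => (lie_mem_bracketChain_pred hBA ha hx : ⁅a, x⁆ ∈ bracketChain B n)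

theorem lie_mem_triangularPart_sub_one
    (hAB : ∀ a ∈ A, ∀ b ∈ B, ∀ c ∈ A, ⁅⁅a, b⁆, c⁆ ∈ A)
    (hBA : ∀ b ∈ B, ∀ a ∈ A, ∀ c ∈ B, ⁅⁅b, a⁆, c⁆ ∈ B) {b x : L} (hb : b ∈ B) :
    ∀ k : ℤ, x ∈ triangularPart A B k → ⁅b, x⁆ ∈ triangularPart A B (k - 1)
  | .ofNat 0, hx => by
    have hx' : x ∈ bracketSpan B A := by rw [bracketSpan_comm]; exact hx
    rw [← lie_skew]
    exact neg_mem (lie_mem_of_mem_bracketSpan_left hBA hx' hb)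
  | .ofNat 1, hx => by
    have : ⁅b, x⁆ ∈ bracketSpan B A := lie_mem_bracketSpan hb hx
    rw [bracketSpan_comm] at this
    exact this
  | .ofNat (n + 2), hx => by
    rw [show Int.ofNat (n + 2) - 1 = Int.ofNat (n + 1) by simp; omega]
    exact lie_mem_bracketChain_pred hAB hb hx
  | .negSucc n, hx => (lie_mem_bracketSpan hb hx : ⁅b, x⁆ ∈ bracketChain B (n + 1))

end LieAlgebra

/-! ### Quotients and generation of Lie algebras -/

namespace LieIdeal

variable {R L L' : Type*} [CommRing R] [LieRing L] [LieAlgebra R L] [LieRing L'] [LieAlgebra R L']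

/-- The homomorphism induced on the quotient by an ideal contained in the kernel. -/
def quotientLift (I : LieIdeal R L) (f : L →ₗ⁅R⁆ L') (h : I ≤ f.ker) : L ⧸ I →ₗ⁅R⁆ L' :=
  { I.toSubmodule.liftQ (f : L →ₗ[R] L') (fun x hx => LieHom.mem_ker.mp (h hx)) with
    map_lie' := by
      intro x y
      obtain ⟨x, rfl⟩ := LieSubmodule.Quotient.surjective_mk' I x
      obtain ⟨y, rfl⟩ := LieSubmodule.Quotient.surjective_mk' I y
      exact LieHom.map_lie f x y }

@[simp]
theorem quotientLift_mk (I : LieIdeal R L) (f : L →ₗ⁅R⁆ L') (h : I ≤ f.ker) (x : L) :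
    I.quotientLift f h (LieSubmodule.Quotient.mk x) = f x :=
  rfl

/-- The projection onto the quotient by an ideal, as a homomorphism of Lie algebras. -/
def quotientMk (I : LieIdeal R L) : L →ₗ⁅R⁆ L ⧸ I :=
  { (LieSubmodule.Quotient.mk' I : L →ₗ[R] L ⧸ I) with
    map_lie' := fun {x y} => LieSubmodule.Quotient.mk_bracket I x y }

theorem quotientMk_surjective (I : LieIdeal R L) : Function.Surjective I.quotientMk :=
  LieSubmodule.Quotient.surjective_mk' I

theorem quotientMk_eq_zero (I : LieIdeal R L) {x : L} : I.quotientMk x = 0 ↔ x ∈ I :=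
  LieSubmodule.Quotient.mk_eq_zero I

end LieIdeal

theorem FreeLieAlgebra.mem_of_forall_of_mem {R X : Type*} [CommRing R]
    (S : LieSubalgebra R (FreeLieAlgebra R X)) (h : ∀ x, FreeLieAlgebra.of R x ∈ S)
    (y : FreeLieAlgebra R X) : y ∈ S := by
  have : S.incl.comp (FreeLieAlgebra.lift R fun x => (⟨FreeLieAlgebra.of R x, h x⟩ : S)) =
      LieHom.id := by
    refine FreeLieAlgebra.hom_ext fun x => ?_
    simp
  have h2 := congrArg (fun f : FreeLieAlgebra R X →ₗ⁅R⁆ FreeLieAlgebra R X => f y) this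
  simp only [LieHom.comp_apply, LieHom.coe_id, id] at h2
  rw [← h2]
  exact Subtype.property _

/-! ### The universal algebra and its levels -/

namespace Kantor

variable {K T : Type*} [Field K] [AddCommGroup T] [Module K T] {σ : K →+* K}
variable (p : T →ₗ[K] T →ₛₗ[σ] T →ₗ[K] T)

/-- The generator `a` of the universal algebra, depending linearly on `a`. -/
noncomputable def posHom : T →ₗ[K] Universal p where
  toFun a := toUniversal p (pos K a)
  map_add' a b := sub_eq_zero.mp <| (LieSubmodule.Quotient.mk_eq_zero _).mpr <|
    LieSubmodule.subset_lieSpan (Relator.pos_add a b)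
  map_smul' k a := sub_eq_zero.mp <| (LieSubmodule.Quotient.mk_eq_zero _).mpr <|
    LieSubmodule.subset_lieSpan (Relator.pos_smul k a)

/-- The generator `τ(a)` of the universal algebra, depending semilinearly on `a`. -/
noncomputable def negHom : T →ₛₗ[σ] Universal p where
  toFun a := toUniversal p (neg K a)
  map_add' a b := sub_eq_zero.mp <| (LieSubmodule.Quotient.mk_eq_zero _).mpr <|
    LieSubmodule.subset_lieSpan (Relator.neg_add a b)
  map_smul' k a := sub_eq_zero.mp <| (LieSubmodule.Quotient.mk_eq_zero _).mpr <|
    LieSubmodule.subset_lieSpan (Relator.neg_smul k a)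

theorem lie_lie_posHom (a b c : T) :
    ⁅⁅posHom p a, negHom p b⁆, posHom p c⁆ = posHom p (p a b c) :=
  sub_eq_zero.mp <| (LieSubmodule.Quotient.mk_eq_zero _).mpr <|
    LieSubmodule.subset_lieSpan (Relator.triple_pos a b c)

theorem lie_lie_negHom (a b c : T) :
    ⁅⁅negHom p a, posHom p b⁆, negHom p c⁆ = negHom p (p a b c) :=
  sub_eq_zero.mp <| (LieSubmodule.Quotient.mk_eq_zero _).mpr <|
    LieSubmodule.subset_lieSpan (Relator.triple_neg a b c)

theorem isMonomial_posHom (a : T) : IsMonomial p 1 (posHom p a) := .pos a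

theorem isMonomial_negHom (a : T) : IsMonomial p (-1) (negHom p a) := .neg a

theorem posHom_mem_level (a : T) : posHom p a ∈ level p 1 :=
  Submodule.subset_span (isMonomial_posHom p a)

theorem negHom_mem_level (a : T) : negHom p a ∈ level p (-1) :=
  Submodule.subset_span (isMonomial_negHom p a)

variable {p}

theorem IsMonomial.rec_hom {P : ∀ k x, IsMonomial p k x → Prop}
    (pos : ∀ a, P 1 (posHom p a) (.pos a)) (neg : ∀ a, P (-1) (negHom p a) (.neg a))
    (bracket : ∀ {i j x y} (hx : IsMonomial p i x) (hy : IsMonomial p j y), P i x hx → P j y hy →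
      P (i + j) ⁅x, y⁆ (.bracket hx hy)) {k x} (h : IsMonomial p k x) : P k x h := by
  induction h with
  | pos a => exact pos a
  | neg a => exact neg a
  | bracket hx hy ihx ihy => exact bracket hx hy ihx ihy

section lift

variable {L : Type*} [LieRing L] [LieAlgebra K L]

/-- The universal property of the universal algebra. -/
noncomputable def universalLift (f : T →ₗ[K] L) (g : T →ₛₗ[σ] L)
    (hf : ∀ a b c, ⁅⁅f a, g b⁆, f c⁆ = f (p a b c))
    (hg : ∀ a b c, ⁅⁅g a, f b⁆, g c⁆ = g (p a b c)) : Universal p →ₗ⁅K⁆ L :=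
  (relatorIdeal p).quotientLift (FreeLieAlgebra.lift K (Sum.elim f g)) <| by
    refine LieSubmodule.lieSpan_le.mpr ?_
    intro x hx
    refine LieHom.mem_ker.mpr ?_
    induction hx <;> simp [-lie_lie, Kantor.pos, Kantor.neg, hf, hg]

variable (f : T →ₗ[K] L) (g : T →ₛₗ[σ] L) (hf : ∀ a b c, ⁅⁅f a, g b⁆, f c⁆ = f (p a b c))
  (hg : ∀ a b c, ⁅⁅g a, f b⁆, g c⁆ = g (p a b c))

@[simp]
theorem universalLift_posHom (a : T) : universalLift f g hf hg (posHom p a) = f a :=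
  (LieIdeal.quotientLift_mk _ _ _ _).trans (FreeLieAlgebra.lift_of_apply _ _)

@[simp]
theorem universalLift_negHom (a : T) : universalLift f g hf hg (negHom p a) = g a :=
  (LieIdeal.quotientLift_mk _ _ _ _).trans (FreeLieAlgebra.lift_of_apply _ _)

end lift

/-- The universal algebra is generated by its levels `1` and `-1`. -/
theorem mem_of_generators_mem (S : LieSubalgebra K (Universal p)) (hpos : ∀ a, posHom p a ∈ S)
    (hneg : ∀ a, negHom p a ∈ S) (x : Universal p) : x ∈ S := by
  obtain ⟨y, rfl⟩ := LieSubmodule.Quotient.surjective_mk' _ x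
  refine FreeLieAlgebra.mem_of_forall_of_mem (S.comap (relatorIdeal p).quotientMk) ?_ y
  rintro (a | a)
  · exact hpos a
  · exact hneg a

theorem lie_mem_iSup_level {x y : Universal p} (hx : x ∈ ⨆ k, level p k)
    (hy : y ∈ ⨆ k, level p k) : ⁅x, y⁆ ∈ ⨆ k, level p k := by
  have hmono : ∀ {k x}, IsMonomial p k x → x ∈ ⨆ k, level p k := fun {k x} hx =>
    Submodule.mem_iSup_of_mem k (Submodule.subset_span hx)
  have hs : ⨆ k, level p k = Submodule.span K {x | ∃ k, IsMonomial p k x} := by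
    simp only [level, ← Submodule.span_iUnion, Set.ofPred_exists]
  rw [hs] at hx hy
  induction hx using Submodule.span_induction with
  | zero => simp
  | add x x' _ _ ihx ihx' => rw [add_lie]; exact add_mem ihx ihx'
  | smul c x _ ih => rw [smul_lie]; exact Submodule.smul_mem _ _ ih
  | mem x hx =>
    obtain ⟨i, hx⟩ := hx
    induction hy using Submodule.span_induction with
    | zero => simp
    | add x x' _ _ ihx ihx' => rw [lie_add]; exact add_mem ihx ihx'
    | smul c x _ ih => rw [lie_smul]; exact Submodule.smul_mem _ _ ih
    | mem y hy =>
      obtain ⟨j, hy⟩ := hy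
      exact hmono (hx.bracket hy)

variable (p) in
theorem iSup_level_eq_top : ⨆ k, level p k = ⊤ := by
  refine eq_top_iff.mpr fun x _ => ?_
  exact mem_of_generators_mem { (⨆ k, level p k) with lie_mem' := lie_mem_iSup_level }
    (fun a => Submodule.mem_iSup_of_mem 1 (posHom_mem_level p a))
    (fun a => Submodule.mem_iSup_of_mem (-1) (negHom_mem_level p a)) x

section triangular

open LieAlgebra

/-- Membership alone does not pass to brackets of arbitrary monomials. The induction therefore also
carries the action of `ad x` on all pieces, which passes to brackets by the Jacobi identity. -/
theorem IsMonomial.mem_triangularPart {k : ℤ} {x : Universal p} (h : IsMonomial p k x) :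
    x ∈ triangularPart (posHom p).range (Submodule.span K (Set.range (negHom p))) k ∧
      ∀ j, ∀ y ∈ triangularPart (posHom p).range (Submodule.span K (Set.range (negHom p))) j,
        ⁅x, y⁆ ∈ triangularPart (posHom p).range (Submodule.span K (Set.range (negHom p))) (j + k) := by
  have hAB : ∀ a ∈ (posHom p).range, ∀ b ∈ Submodule.span K (Set.range (negHom p)),
      ∀ c ∈ (posHom p).range, ⁅⁅a, b⁆, c⁆ ∈ (posHom p).range := by
    rintro _ ⟨a, rfl⟩ b hb _ ⟨c, rfl⟩
    induction hb using Submodule.span_induction with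
    | zero => simp
    | add x y _ _ hx hy => rw [lie_add, add_lie]; exact add_mem hx hy
    | smul r x _ hx => rw [lie_smul, smul_lie]; exact Submodule.smul_mem _ _ hx
    | mem x hx =>
      obtain ⟨b, rfl⟩ := hx
      exact ⟨p a b c, (lie_lie_posHom p a b c).symm⟩
  have hBA : ∀ b ∈ Submodule.span K (Set.range (negHom p)), ∀ a ∈ (posHom p).range,
      ∀ c ∈ Submodule.span K (Set.range (negHom p)),
        ⁅⁅b, a⁆, c⁆ ∈ Submodule.span K (Set.range (negHom p)) := by
    rintro b hb _ ⟨a, rfl⟩ c hc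
    induction hb using Submodule.span_induction with
    | zero => simp
    | add x y _ _ hx hy => rw [add_lie, add_lie]; exact add_mem hx hy
    | smul r x _ hx => rw [smul_lie, smul_lie]; exact Submodule.smul_mem _ _ hx
    | mem x hx =>
      obtain ⟨b, rfl⟩ := hx
      induction hc using Submodule.span_induction with
      | zero => simp
      | add x y _ _ hx hy => rw [lie_add]; exact add_mem hx hy
      | smul r x _ hx => rw [lie_smul]; exact Submodule.smul_mem _ _ hx
      | mem x hx =>
        obtain ⟨c, rfl⟩ := hx
        exact Submodule.subset_span ⟨p b a c, (lie_lie_negHom p b a c).symm⟩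
  induction h using IsMonomial.rec_hom with
  | pos a =>
    exact ⟨⟨a, rfl⟩, fun j y hy => lie_mem_triangularPart_add_one hAB hBA ⟨a, rfl⟩ j hy⟩
  | neg a =>
    exact ⟨Submodule.subset_span ⟨a, rfl⟩, fun j y hy =>
      lie_mem_triangularPart_sub_one hAB hBA (Submodule.subset_span ⟨a, rfl⟩) j hy⟩
  | @bracket i j x y hx hy ihx ihy =>
    refine ⟨add_comm j i ▸ ihx.2 j y ihy.1, fun k z hz => ?_⟩
    rw [lie_lie]
    refine sub_mem ?_ ?_
    · rw [add_comm i j, ← add_assoc]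
      exact ihx.2 _ _ (ihy.2 _ _ hz)
    · rw [← add_assoc]
      exact ihy.2 _ _ (ihx.2 _ _ hz)

variable (p) in
theorem level_neg_one_le : level p (-1) ≤ Submodule.span K (Set.range (negHom p)) :=
  Submodule.span_le.mpr fun _ hx => hx.mem_triangularPart.1

end triangular

/-! ### The grading as an eigenspace decomposition -/

section scale

variable [CharZero K]

variable (p) in
/-- The endomorphism of the universal algebra that multiplies level `k` by `2 ^ k`. -/
noncomputable def scale : Universal p →ₗ⁅K⁆ Universal p :=
  universalLift ((2 : K) • posHom p) ((2 : K)⁻¹ • negHom p)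
    (fun a b c => by simp [-lie_lie, lie_lie_posHom])
    (fun a b c => by simp [-lie_lie, lie_lie_negHom])

theorem scale_posHom (a : T) : scale p (posHom p a) = (2 : K) • posHom p a := by
  simp [scale]

theorem scale_negHom (a : T) : scale p (negHom p a) = (2 : K)⁻¹ • negHom p a := by
  simp [scale]

theorem scale_of_mem_level {k : ℤ} {x : Universal p} (hx : x ∈ level p k) :
    scale p x = (2 : K) ^ k • x := by
  induction hx using Submodule.span_induction with
  | zero => simp
  | add x y _ _ hx hy => rw [map_add, hx, hy, smul_add]
  | smul c x _ h => rw [map_smul, h, smul_comm]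
  | mem x hx =>
    induction hx using IsMonomial.rec_hom with
    | pos a => simp [scale_posHom]
    | neg a => simp [scale_negHom]
    | bracket hx hy ihx ihy =>
      rw [LieHom.map_lie, ihx, ihy, smul_lie, lie_smul, smul_smul, zpow_add₀ two_ne_zero]

theorem scale_surjective : Function.Surjective (scale p) := fun x => by
  refine mem_of_generators_mem (scale p).range (fun a => ⟨(2 : K)⁻¹ • posHom p a, ?_⟩)
    (fun a => ⟨(2 : K) • negHom p a, ?_⟩) x
  · simp [scale_posHom]
  · simp [scale_negHom]

/-- In characteristic zero `2` has infinite multiplicative order, so different levels have different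
eigenvalues under `scale`. -/
theorem two_zpow_injective : Function.Injective fun k : ℤ => (2 : K) ^ k := fun i j h => by
  refine zpow_right_injective₀ (a := (2 : ℚ)) two_pos (by norm_num) (Rat.cast_injective (α := K) ?_)
  simpa using h

variable (p) in
theorem iSupIndep_level : iSupIndep (level p) := by
  have h := (Module.End.eigenspaces_iSupIndep (scale p : Universal p →ₗ[K] Universal p)).comp
    two_zpow_injective
  exact h.mono fun k x hx => Module.End.mem_eigenspace_iff.mpr (scale_of_mem_level hx)

theorem scale_mem_of_isGradedIdeal {I : LieIdeal K (Universal p)} (hI : IsGradedIdeal p I)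
    {x : Universal p} (hx : x ∈ I) : scale p x ∈ I := by
  have : I.toSubmodule ≤ I.toSubmodule.comap (scale p : Universal p →ₗ[K] Universal p) := by
    conv_lhs => rw [hI]
    refine iSup_le fun k y hy => ?_
    rw [Submodule.mem_comap, LieHom.coe_toLinearMap, scale_of_mem_level hy.2]
    exact Submodule.smul_mem _ _ hy.1
  exact this hx

theorem scale_mem_maxIdeal {x : Universal p} (hx : x ∈ maxIdeal p) : scale p x ∈ maxIdeal p := by
  have : (maxIdeal p).toSubmodule ≤
      (maxIdeal p).toSubmodule.comap (scale p : Universal p →ₗ[K] Universal p) := by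
    conv_lhs => rw [maxIdeal, LieSubmodule.sSup_toSubmodule]
    refine sSup_le ?_
    rintro _ ⟨I, hI, rfl⟩ y hy
    exact le_sSup (α := LieIdeal K (Universal p)) hI (scale_mem_of_isGradedIdeal hI.1 hy)
  exact this hx

-- A sum of ideals that miss level `1` might meet it. Gradedness places each of them in the sum of
-- the other levels, and this sum is independent of level `1`.
variable (p) in
theorem disjoint_maxIdeal_level_one : Disjoint (maxIdeal p).toSubmodule (level p 1) := by
  refine ((iSupIndep_level p) 1).symm.mono_left ?_
  rw [maxIdeal, LieSubmodule.sSup_toSubmodule]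
  refine sSup_le ?_
  rintro _ ⟨I, ⟨hI, h1, -⟩, rfl⟩
  rw [hI]
  refine iSup_le fun k => ?_
  by_cases hk : k = 1
  · subst hk; rw [h1]; exact bot_le
  · exact inf_le_right.trans (le_iSup₂_of_le k hk le_rfl)

end scale

end Kantor

/-! ### Endomorphisms of the tensor algebra defined by recursion -/

namespace TensorAlgebra

variable {R M : Type*} [CommRing R] [AddCommGroup M] [Module R M]

/-- Left multiplication by elements of `M` on the tensor algebra. -/
noncomputable def mulι (R M : Type*) [CommRing R] [AddCommGroup M] [Module R M] :
    M →ₗ[R] Module.End R (TensorAlgebra R M) :=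
  (LinearMap.mul R (TensorAlgebra R M)).comp (TensorAlgebra.ι R)

@[simp]
theorem mulι_apply (a : M) (x : TensorAlgebra R M) : mulι R M a x = TensorAlgebra.ι R a * x :=
  rfl

/-- An endomorphism that kills `1` and commutes with left multiplications vanishes. -/
theorem end_eq_zero {X : Module.End R (TensorAlgebra R M)} (h1 : X 1 = 0)
    (h : ∀ a x, X (mulι R M a x) = mulι R M a (X x)) : X = 0 := by
  have key : ∀ y x, X (y * x) = y * X x := fun y => by
    induction y using TensorAlgebra.induction with
    | algebraMap r => intro x; rw [← Algebra.smul_def, map_smul, ← Algebra.smul_def]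
    | ι a => exact h a
    | mul y z hy hz => intro x; rw [mul_assoc, hy, hz, mul_assoc]
    | add y z hy hz => intro x; rw [add_mul, map_add, hy, hz, add_mul]
  ext x
  simpa [h1] using key x 1

theorem end_ext {X Y : Module.End R (TensorAlgebra R M)} (h1 : X 1 = Y 1)
    (h : ∀ a x, X (mulι R M a x) - mulι R M a (X x) = Y (mulι R M a x) - mulι R M a (Y x)) :
    X = Y := by
  refine sub_eq_zero.mp (end_eq_zero (by simp [h1]) fun a x => ?_)
  rw [LinearMap.sub_apply, LinearMap.sub_apply, map_sub, ← sub_eq_zero, sub_sub_sub_comm, h,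
    sub_self]

/-- The endomorphism with prescribed commutators with left multiplications that kills `1`. -/
noncomputable def recEnd (N : M →ₗ[R] Module.End R (TensorAlgebra R M)) :
    Module.End R (TensorAlgebra R M) :=
  -- Block triangular matrices with `mulι a` on the diagonal and `N a` below it: from `(1, 0)`, the
  -- first entry records the tensor and the second accumulates the Leibniz terms.
  let step : M →ₗ[R] Module.End R (TensorAlgebra R M × TensorAlgebra R M) :=
    { toFun := fun a => (mulι R M a).prodMap (mulι R M a) +
        LinearMap.inr R _ _ ∘ₗ N a ∘ₗ LinearMap.fst R _ _
      map_add' := fun a b => by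
        refine LinearMap.ext fun x => ?_
        ext <;> simp [add_add_add_comm]
      map_smul' := fun r a => by
        refine LinearMap.ext fun x => ?_
        ext <;> simp }
  LinearMap.snd R _ _ ∘ₗ
    LinearMap.applyₗ ((1, 0) : TensorAlgebra R M × TensorAlgebra R M) ∘ₗ
      (TensorAlgebra.lift R step).toLinearMap

theorem recEnd_one (N : M →ₗ[R] Module.End R (TensorAlgebra R M)) : recEnd N 1 = 0 := by
  simp [recEnd]

theorem recEnd_mulι (N : M →ₗ[R] Module.End R (TensorAlgebra R M)) (a : M)
    (x : TensorAlgebra R M) : recEnd N (mulι R M a x) = mulι R M a (recEnd N x) + N a x := by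
  have key : ∀ (step : M →ₗ[R] Module.End R (TensorAlgebra R M × TensorAlgebra R M)),
      (∀ a v, (step a v).1 = TensorAlgebra.ι R a * v.1) →
        ∀ y v, (TensorAlgebra.lift R step y v).1 = y * v.1 := fun step hs y => by
    induction y using TensorAlgebra.induction with
    | algebraMap r => intro v; simp [Algebra.smul_def]
    | ι a => intro v; simp [hs]
    | mul y z hy hz => intro v; simp [hy, hz, mul_assoc]
    | add y z hy hz => intro v; simp [hy, hz, add_mul]
  simp only [recEnd, LinearMap.comp_apply, mulι_apply, AlgHom.toLinearMap_apply, map_mul,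
    TensorAlgebra.lift_ι_apply, LinearMap.applyₗ_apply_apply, Module.End.mul_apply,
    LinearMap.snd_apply, LinearMap.coe_mk, AddHom.coe_mk, LinearMap.add_apply,
    LinearMap.prodMap_apply, Prod.snd_add, LinearMap.inr_apply, LinearMap.fst_apply]
  rw [key _ (by simp), mul_one]

end TensorAlgebra

/-! ### Representation on the tensor algebra -/

namespace Kantor

open TensorAlgebra

attribute [local instance 100] LieRing.ofAssociativeRing

variable {K T : Type*} [Field K] [AddCommGroup T] [Module K T] {σ : K →+* K}
variable (p : T →ₗ[K] T →ₛₗ[σ] T →ₗ[K] T)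

/-- The derivation of the tensor algebra that extends `c ↦ (abc)`. -/
noncomputable def tensorDer (a b : T) : Module.End K (TensorAlgebra K T) :=
  recEnd (mulι K T ∘ₗ p a b)

theorem tensorDer_one (a b : T) : tensorDer p a b 1 = 0 := recEnd_one _

theorem tensorDer_mulι (a b c : T) (x : TensorAlgebra K T) :
    tensorDer p a b (mulι K T c x) = mulι K T c (tensorDer p a b x) + mulι K T (p a b c) x :=
  recEnd_mulι _ _ _

theorem tensorDer_add_left (a a' b : T) :
    tensorDer p (a + a') b = tensorDer p a b + tensorDer p a' b := by
  refine end_ext (by simp [tensorDer_one]) fun c x => ?_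
  simp only [tensorDer_mulι, LinearMap.add_apply, map_add]
  abel

theorem tensorDer_smul_left (r : K) (a b : T) :
    tensorDer p (r • a) b = r • tensorDer p a b := by
  refine end_ext (by simp [tensorDer_one]) fun c x => ?_
  simp only [tensorDer_mulι, LinearMap.smul_apply, map_smul, smul_add]
  abel

theorem tensorDer_add_right (a b b' : T) :
    tensorDer p a (b + b') = tensorDer p a b + tensorDer p a b' := by
  refine end_ext (by simp [tensorDer_one]) fun c x => ?_
  simp only [tensorDer_mulι, LinearMap.add_apply, map_add]
  abel

theorem tensorDer_smul_right (r : K) (a b : T) :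
    tensorDer p a (r • b) = σ r • tensorDer p a b := by
  refine end_ext (by simp [tensorDer_one]) fun c x => ?_
  simp only [tensorDer_mulι, LinearMap.smul_apply, map_smul, map_smulₛₗ, smul_add]
  abel

/-- The commutator of two of the derivations is given by the commutator of the operators that they
extend. -/
theorem tensorDer_commutator (hp : IsGeneralizedJordan p) (a b c d : T) (x : TensorAlgebra K T) :
    tensorDer p a b (tensorDer p c d x) - tensorDer p c d (tensorDer p a b x) =
      tensorDer p (p a b c) d x - tensorDer p c (p b a d) x := by
  have : tensorDer p a b * tensorDer p c d - tensorDer p c d * tensorDer p a b =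
      tensorDer p (p a b c) d - tensorDer p c (p b a d) := by
    refine end_ext (by simp [tensorDer_one]) fun e x => ?_
    have h := congrArg (fun y => mulι K T y x) (hp a b c d e)
    simp only [map_sub, LinearMap.sub_apply] at h
    simp only [tensorDer_mulι, LinearMap.sub_apply, Module.End.mul_apply, map_sub, map_add]
    refine sub_eq_zero.mp (Eq.trans ?_ (sub_eq_zero.mpr h))
    abel
  exact congrArg (fun f : Module.End K (TensorAlgebra K T) => f x) this

/-- The operator on the tensor algebra that represents `τ(b)`. -/
noncomputable def tensorNeg (b : T) : Module.End K (TensorAlgebra K T) :=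
  recEnd
    { toFun := fun a => -tensorDer p a b
      map_add' := fun a a' => by rw [tensorDer_add_left, neg_add]
      map_smul' := fun r a => by rw [tensorDer_smul_left, smul_neg, RingHom.id_apply] }

theorem tensorNeg_one (b : T) : tensorNeg p b 1 = 0 := recEnd_one _

theorem tensorNeg_mulι (b c : T) (x : TensorAlgebra K T) :
    tensorNeg p b (mulι K T c x) = mulι K T c (tensorNeg p b x) - tensorDer p c b x :=
  (recEnd_mulι _ _ _).trans (sub_eq_add_neg _ _).symm

/-- `tensorNeg` as a semilinear map. -/
noncomputable def tensorNegHom : T →ₛₗ[σ] Module.End K (TensorAlgebra K T) where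
  toFun := tensorNeg p
  map_add' b b' := by
    refine end_ext (by simp [tensorNeg_one]) fun c x => ?_
    simp only [tensorNeg_mulι, LinearMap.add_apply, map_add, tensorDer_add_right]
    abel
  map_smul' r b := by
    refine end_ext (by simp [tensorNeg_one]) fun c x => ?_
    simp only [tensorNeg_mulι, LinearMap.smul_apply, map_smul, tensorDer_smul_right, smul_sub]
    abel

theorem lie_mulι_tensorNeg (a b : T) : ⁅mulι K T a, tensorNegHom p b⁆ = tensorDer p a b := by
  ext x
  change mulι K T a (tensorNeg p b x) - tensorNeg p b (mulι K T a x) = _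
  rw [tensorNeg_mulι, sub_sub_cancel]

theorem lie_tensorDer_mulι (a b c : T) : ⁅tensorDer p a b, mulι K T c⁆ = mulι K T (p a b c) := by
  ext x
  change tensorDer p a b (mulι K T c x) - mulι K T c (tensorDer p a b x) = _
  rw [tensorDer_mulι, add_sub_cancel_left]

/-- Both sides kill `1`, and their commutators with left multiplications agree by the Jordan
identity in the form `tensorDer_commutator`. This yields the relation for `τ` in `tensorRep`. -/
theorem lie_tensorDer_tensorNeg (hp : IsGeneralizedJordan p) (a b c : T) :
    ⁅tensorDer p a b, tensorNegHom p c⁆ = -tensorNegHom p (p b a c) := by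
  change tensorDer p a b * tensorNeg p c - tensorNeg p c * tensorDer p a b = -tensorNeg p (p b a c)
  refine end_ext (by simp [tensorDer_one, tensorNeg_one]) fun d x => ?_
  have h := tensorDer_commutator p hp a b d c x
  simp only [tensorDer_mulι, tensorNeg_mulι, LinearMap.sub_apply, Module.End.mul_apply, map_sub,
    map_add, LinearMap.neg_apply, map_neg]
  refine sub_eq_zero.mp (Eq.trans ?_ (sub_eq_zero.mpr h.symm))
  abel

/-- The representation of the universal algebra on the tensor algebra. -/
noncomputable def tensorRep (hp : IsGeneralizedJordan p) :
    Universal p →ₗ⁅K⁆ Module.End K (TensorAlgebra K T) :=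
  universalLift (mulι K T) (tensorNegHom p)
    (fun a b c => by rw [lie_mulι_tensorNeg, lie_tensorDer_mulι])
    (fun a b c => by
      rw [← lie_skew (tensorNegHom p a), neg_lie, lie_mulι_tensorNeg,
        lie_tensorDer_tensorNeg p hp, neg_neg])

theorem posHom_injective (hp : IsGeneralizedJordan p) : Function.Injective (posHom p) := by
  refine (injective_iff_map_eq_zero _).mpr fun a ha => ?_
  have h1 : tensorRep p hp (posHom p a) = mulι K T a := universalLift_posHom _ _ _ _ _
  rw [ha, map_zero] at h1
  have h2 := congrArg (fun f : Module.End K (TensorAlgebra K T) => f 1) h1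
  simpa using h2.symm

end Kantor

/-! ### Killing form of the associated graded Lie algebra -/

namespace Kantor

open LieAlgebra

attribute [local instance 100] LieRing.ofAssociativeRing

variable {K T : Type*} [Field K] [AddCommGroup T] [Module K T] {σ : K →+* K}

section

variable (p : T →ₗ[K] T →ₛₗ[σ] T →ₗ[K] T)

/-- The projection of the universal algebra onto the associated graded Lie algebra. -/
noncomputable def toLieAlg : Universal p →ₗ⁅K⁆ LieAlg p := (maxIdeal p).quotientMk

theorem toLieAlg_surjective : Function.Surjective (toLieAlg p) := LieIdeal.quotientMk_surjective _

/-- The endomorphism of the associated graded Lie algebra that multiplies level `k` by `2 ^ k`. -/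
noncomputable def lieAlgScale [CharZero K] : LieAlg p →ₗ⁅K⁆ LieAlg p :=
  (maxIdeal p).quotientLift ((toLieAlg p).comp (scale p)) fun _ hx =>
    LieHom.mem_ker.mpr ((LieIdeal.quotientMk_eq_zero _).mpr (scale_mem_maxIdeal hx))

theorem lieAlgScale_toLieAlg [CharZero K] (x : Universal p) :
    lieAlgScale p (toLieAlg p x) = toLieAlg p (scale p x) :=
  rfl

theorem lieAlgScale_surjective [CharZero K] : Function.Surjective (lieAlgScale p) := fun x => by
  obtain ⟨y, rfl⟩ := toLieAlg_surjective p x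
  obtain ⟨z, rfl⟩ := scale_surjective y
  exact ⟨toLieAlg p z, rfl⟩

/-- Level `1` of the associated graded Lie algebra is a copy of `T`. -/
theorem toLieAlg_posHom_injective [CharZero K] (hp : IsGeneralizedJordan p) :
    Function.Injective fun a => toLieAlg p (posHom p a) := by
  have h : Function.Injective ((toLieAlg p : Universal p →ₗ[K] LieAlg p) ∘ₗ posHom p) := by
    refine (injective_iff_map_eq_zero _).mpr fun a ha => ?_
    have h1 : posHom p a ∈ maxIdeal p := (LieIdeal.quotientMk_eq_zero _).mp ha
    have h2 := (Submodule.disjoint_def.mp (disjoint_maxIdeal_level_one p)) _ h1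
      (posHom_mem_level p a)
    exact posHom_injective p hp (h2.trans (map_zero _).symm)
  exact h

end

variable {p : T →ₗ[K] T →ₛₗ[σ] T →ₗ[K] T}

/-- The span of all products is stable under both operations of K-simplicity. -/
theorem span_range_product_eq_top (hs : IsKSimple p) (h0 : p ≠ 0) :
    Submodule.span K {x | ∃ a b c, p a b c = x} = ⊤ := by
  refine (hs (Submodule.span K {x | ∃ a b c, p a b c = x})
    (fun u _ a b => Submodule.subset_span ⟨a, b, u, rfl⟩)
    (fun u _ a b => Submodule.subset_span ⟨u, a, b, rfl⟩)).resolve_left fun h => h0 ?_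
  ext a b c
  exact (Submodule.mem_bot K).mp (h ▸ Submodule.subset_span ⟨a, b, c, rfl⟩)

/-- An ideal that contains a generating set of level `1` contains level `1` of its derived ideals. -/
theorem posHom_mem_derivedSeriesOfIdeal (hs : IsKSimple p) (h0 : p ≠ 0) {I : LieIdeal K (LieAlg p)}
    (hI : ∀ a, toLieAlg p (posHom p a) ∈ I) (n : ℕ) (a : T) :
    toLieAlg p (posHom p a) ∈ derivedSeriesOfIdeal K (LieAlg p) n I := by
  induction n generalizing a with
  | zero => exact hI a
  | succ n ih =>
    rw [derivedSeriesOfIdeal_succ]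
    set D := derivedSeriesOfIdeal K (LieAlg p) n I
    have h : Submodule.span K {x | ∃ a b c, p a b c = x} ≤ (⁅D, D⁆ : LieIdeal K _).toSubmodule.comap
        ((toLieAlg p : Universal p →ₗ[K] LieAlg p) ∘ₗ posHom p) := by
      refine Submodule.span_le.mpr ?_
      rintro _ ⟨a, b, c, rfl⟩
      change toLieAlg p (posHom p (p a b c)) ∈ ⁅D, D⁆
      rw [← lie_lie_posHom, LieHom.map_lie, LieHom.map_lie]
      -- `τ(b)` need not lie in `D`: the ideal property absorbs it into `[a, τ(b)]`.
      exact LieSubmodule.lie_mem_lie (lie_mem_left K _ D _ _ (ih a)) (ih c)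
    rw [span_range_product_eq_top hs h0] at h
    exact h Submodule.mem_top

theorem lie_lie_self_eq_zero [CharZero K] (hA : IsAntisymmFirstThird p) (a b : T) :
    ⁅⁅posHom p a, negHom p b⁆, posHom p a⁆ = 0 := by
  have h : (2 : K) • p a b a = 0 := by
    rw [two_smul]
    nth_rewrite 1 [hA a b a]
    exact neg_add_cancel _
  rw [lie_lie_posHom, (smul_eq_zero.mp h).resolve_left two_ne_zero, map_zero]

section FiniteDimensional

variable [CharZero K] [FiniteDimensional K (LieAlg p)]

theorem killingForm_lieAlgScale (x y : LieAlg p) :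
    killingForm K (LieAlg p) (lieAlgScale p x) (lieAlgScale p y) = killingForm K (LieAlg p) x y :=
  killingForm_of_equiv_apply (LieEquiv.ofBijective (lieAlgScale p)
    ⟨(LinearMap.injective_iff_surjective (f := (lieAlgScale p : LieAlg p →ₗ[K] LieAlg p))).mpr
      (lieAlgScale_surjective p), lieAlgScale_surjective p⟩) x y

theorem killingForm_posHom_negHom (hA : IsAntisymmFirstThird p) (a b : T) :
    killingForm K (LieAlg p) (toLieAlg p (posHom p a)) (toLieAlg p (negHom p b)) = 0 := by
  set x := toLieAlg p (posHom p a) with hx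
  set y := toLieAlg p (negHom p b) with hy
  have had : ad K (LieAlg p) ⁅x, y⁆ = ad K (LieAlg p) x * ad K (LieAlg p) y -
      ad K (LieAlg p) y * ad K (LieAlg p) x := LieHom.map_lie _ _ _
  have hxyx : ⁅⁅x, y⁆, x⁆ = 0 := by
    rw [hx, hy, ← LieHom.map_lie, ← LieHom.map_lie, lie_lie_self_eq_zero hA, map_zero]
  have hSx : lieAlgScale p x = (2 : K) • x := by
    rw [hx, lieAlgScale_toLieAlg, scale_posHom, map_smul]
  have hSy : lieAlgScale p y = (2 : K)⁻¹ • y := by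
    rw [hy, lieAlgScale_toLieAlg, scale_negHom, map_smul]
  have hnil : IsNilpotent (ad K (LieAlg p) x * ad K (LieAlg p) y -
      ad K (LieAlg p) y * ad K (LieAlg p) x) := by
    apply isNilpotent_of_commute_commutator
    rw [← had]
    refine sub_eq_zero.mp ((LieHom.map_lie (ad K (LieAlg p)) ⁅x, y⁆ x).symm.trans ?_)
    rw [hxyx, map_zero]
  rw [LieModule.traceForm_comm, killingForm_apply_apply]
  refine trace_mul_eq_zero_of_isNilpotent_commutator (c := (2 : K))
    (S := (lieAlgScale p : LieAlg p →ₗ[K] LieAlg p)) (fun n h => ?_)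
    (LinearMap.injective_iff_surjective.mpr (lieAlgScale_surjective p)) ?_ ?_ hnil
  · have : ((n + 1 : ℕ) : ℤ) = 0 := two_zpow_injective (K := K)
      (by simpa only [zpow_natCast, zpow_zero] using h)
    omega
  · ext z
    change lieAlgScale p ⁅x, z⁆ = (2 : K) • ⁅x, lieAlgScale p z⁆
    rw [LieHom.map_lie, hSx, smul_lie]
  · rw [← had]
    ext z
    change lieAlgScale p ⁅⁅x, y⁆, z⁆ = ⁅⁅x, y⁆, lieAlgScale p z⁆
    rw [LieHom.map_lie, LieHom.map_lie, hSx, hSy, smul_lie, lie_smul, smul_smul,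
      mul_inv_cancel₀ two_ne_zero, one_smul]

theorem killingForm_posHom (hA : IsAntisymmFirstThird p) (a : T) (z : LieAlg p) :
    killingForm K (LieAlg p) (toLieAlg p (posHom p a)) z = 0 := by
  have key : (⨆ k, level p k) ≤ (killingForm K (LieAlg p) (toLieAlg p (posHom p a)) ∘ₗ
      (toLieAlg p : Universal p →ₗ[K] LieAlg p)).ker := by
    refine iSup_le fun k => ?_
    by_cases hk : k = -1
    · subst hk
      refine (level_neg_one_le p).trans (Submodule.span_le.mpr ?_)
      rintro _ ⟨b, rfl⟩
      exact killingForm_posHom_negHom hA a b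
    · intro y hy
      -- Invariance multiplies the value by `2 * 2 ^ k`, which is `1` only for `k = -1`.
      have h := killingForm_lieAlgScale (toLieAlg p (posHom p a)) (toLieAlg p y)
      rw [lieAlgScale_toLieAlg, lieAlgScale_toLieAlg, scale_posHom, scale_of_mem_level hy, map_smul,
        map_smul, map_smul, map_smul, LinearMap.smul_apply, smul_eq_mul, smul_eq_mul, ← mul_assoc,
        ← sub_eq_zero, ← sub_one_mul] at h
      refine (mul_eq_zero.mp h).resolve_left fun h1 => hk ?_
      have h2 : k + 1 = 0 := two_zpow_injective (K := K) <| by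
        simpa only [zpow_add_one₀ (two_ne_zero (α := K)), zpow_zero] using sub_eq_zero.mp h1
      omega
  rw [iSup_level_eq_top] at key
  obtain ⟨y, rfl⟩ := toLieAlg_surjective p z
  exact key Submodule.mem_top

end FiniteDimensional

theorem not_finiteDimensional_lieAlg [CharZero K] (hp : IsGeneralizedJordan p) (hs : IsKSimple p)
    (h0 : p ≠ 0) (hA : IsAntisymmFirstThird p) : ¬ FiniteDimensional K (LieAlg p) := by
  intro _
  -- Cartan's criterion: the kernel of the Killing form is a solvable ideal.
  have hmem : ∀ a, toLieAlg p (posHom p a) ∈ radical K (LieAlg p) := fun a =>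
    killingCompl_top_le_radical K (LieAlg p) <| (LieIdeal.mem_killingCompl K (LieAlg p) ⊤).mpr
      fun y _ => (LieModule.traceForm_comm K _ _ _ _).trans (killingForm_posHom hA a y)
  obtain ⟨n, hn⟩ := (IsSolvable.solvable K (radical K (LieAlg p)))
  rw [LieIdeal.derivedSeries_eq_bot_iff] at hn
  refine h0 ?_
  ext a b c
  have h := posHom_mem_derivedSeriesOfIdeal hs h0 hmem n (p a b c)
  rw [hn, LieSubmodule.mem_bot] at h
  exact toLieAlg_posHom_injective p hp (by simpa using h)

end Kantor

/-! ### The epsilon tensor example -/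

/-- The right side is a Vandermonde product, alternating in the indices, with value `12` at `0, 1,
2, 3`. -/
theorem twelve_mul_epsilonTensor : ∀ i j k l : Fin 4, 12 * epsilonTensor i j k l =
    ((j : ℤ) - i) * (k - i) * (l - i) * (k - j) * (l - j) * (l - k) := by
  decide +kernel

theorem epsilonTensor_eq (i j k l : Fin 4) : epsilonTensor i j k l =
    ((j : ℤ) - i) * (k - i) * (l - i) * (k - j) * (l - j) * (l - k) / 12 := by
  rw [← twelve_mul_epsilonTensor, Int.mul_ediv_cancel_left _ (by norm_num)]

section

variable {K : Type*} [Field K] (σ : K →+* K) (c : K)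

theorem blgProduct_apply (x y z : Fin 4 → K) (l : Fin 4) : blgProduct σ c x y z l =
    ∑ i, ∑ j, ∑ k, c * (epsilonTensor i j k l : K) * x i * σ (y j) * z k :=
  rfl

theorem blgProduct_eq (x y z : Fin 4 → K) : blgProduct σ c x y z =
    ![c * (-x 1 * (σ (y 2) * z 3 - σ (y 3) * z 2) - x 2 * (σ (y 3) * z 1 - σ (y 1) * z 3)
        - x 3 * (σ (y 1) * z 2 - σ (y 2) * z 1)),
      c * (x 0 * (σ (y 2) * z 3 - σ (y 3) * z 2) + x 2 * (σ (y 3) * z 0 - σ (y 0) * z 3)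
        + x 3 * (σ (y 0) * z 2 - σ (y 2) * z 0)),
      c * (-x 0 * (σ (y 1) * z 3 - σ (y 3) * z 1) - x 1 * (σ (y 3) * z 0 - σ (y 0) * z 3)
        - x 3 * (σ (y 0) * z 1 - σ (y 1) * z 0)),
      c * (x 0 * (σ (y 1) * z 2 - σ (y 2) * z 1) + x 1 * (σ (y 2) * z 0 - σ (y 0) * z 2)
        + x 2 * (σ (y 0) * z 1 - σ (y 1) * z 0))] := by
  funext l
  fin_cases l <;> simp [blgProduct_apply, epsilonTensor_eq, Fin.sum_univ_four] <;> ring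

variable {σ c}

/-- The inner product in the middle slot produces `σ c` and applies `σ` twice to the entries of `a`;
the two hypotheses undo this. -/
theorem blgProduct_isGeneralizedJordan (hσ : ∀ r, σ (σ r) = r) (hc : σ c = c) :
    IsGeneralizedJordan (blgProduct σ c) := by
  intro a b x y z
  simp only [blgProduct_eq]
  funext l
  fin_cases l <;> simp [hσ, hc] <;> ring

theorem blgProduct_isAntisymmFirstThird : IsAntisymmFirstThird (blgProduct σ c) := by
  intro x y z
  simp only [blgProduct_eq]
  funext l
  fin_cases l <;> simp <;> ring

end

section

variable {K : Type*} [Field K] {σ : K →+* K} {c : K}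

-- Let `m` be the fourth index. The inner product sends `e_l` to `± c e_m` and `e_m` to a multiple
-- of `e_l`. The outer one kills `e_l` and returns `e_m` to `± c e_j`, so only the coordinate `u l`
-- survives.
set_option maxHeartbeats 800000 in
theorem blgProduct_blgProduct_single (u : Fin 4 → K) (j k l : Fin 4) (hjk : j ≠ k) (hjl : j ≠ l)
    (hkl : k ≠ l) :
    blgProduct σ c (blgProduct σ c u (Pi.single j 1) (Pi.single k 1)) (Pi.single l 1)
      (Pi.single k 1) = (c ^ 2 * u l) • Pi.single j 1 := by
  simp only [blgProduct_eq]
  fin_cases j <;> fin_cases k <;> first | exact absurd rfl hjk | skip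
  all_goals fin_cases l <;> first | exact absurd rfl hjl | exact absurd rfl hkl | skip
  all_goals
    funext m
    fin_cases m <;> simp <;> ring

theorem single_mem_of_apply_ne_zero (hc : c ≠ 0) {U : Submodule K (Fin 4 → K)}
    (hU : ∀ u ∈ U, ∀ a b, blgProduct σ c u a b ∈ U) {u : Fin 4 → K} (hu : u ∈ U) {j l : Fin 4}
    (hjl : j ≠ l) (hl : u l ≠ 0) : Pi.single j 1 ∈ U := by
  obtain ⟨k, hjk, hkl⟩ : ∃ k, j ≠ k ∧ k ≠ l :=
    (by decide : ∀ j l : Fin 4, ∃ k, j ≠ k ∧ k ≠ l) j l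
  have h := hU _ (hU u hu (Pi.single j 1) (Pi.single k 1)) (Pi.single l 1) (Pi.single k 1)
  rw [blgProduct_blgProduct_single u j k l hjk hjl hkl] at h
  exact (U.smul_mem_iff (mul_ne_zero (pow_ne_zero 2 hc) hl)).mp h

theorem blgProduct_isKSimple (hc : c ≠ 0) : IsKSimple (blgProduct σ c) := by
  intro U _ hU
  refine or_iff_not_imp_left.mpr fun hne => ?_
  obtain ⟨u, hu, hu0⟩ := U.exists_mem_ne_zero_of_ne_bot hne
  obtain ⟨l, hl⟩ := Function.ne_iff.mp hu0
  have h1 : ∀ j, Pi.single j 1 ∈ U := fun j => by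
    by_cases hjl : j = l
    -- The index `l` itself is reached by a detour: first `e_m` with `m ≠ l`, then `e_l` from `e_m`.
    · obtain ⟨m, hm⟩ := exists_ne l
      have h2 : Pi.single m 1 ∈ U := single_mem_of_apply_ne_zero hc hU hu hm hl
      exact single_mem_of_apply_ne_zero hc hU h2 (hjl ▸ hm.symm) (by simp)
    · exact single_mem_of_apply_ne_zero hc hU hu hjl hl
  rw [eq_top_iff, ← (Pi.basisFun K (Fin 4)).span_eq, Submodule.span_le]
  rintro _ ⟨j, rfl⟩
  simpa using h1 j

theorem blgProduct_ne_zero (hc : c ≠ 0) : blgProduct σ c ≠ 0 := fun h => by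
  have h1 := blgProduct_blgProduct_single (σ := σ) (c := c) (Pi.single 0 1) 1 2 0 (by decide)
    (by decide) (by decide)
  rw [h] at h1
  have h2 : 0 = c ^ 2 := by simpa using congrFun h1 1
  exact pow_ne_zero 2 hc h2.symm

end

theorem mainTheorem1 {K : Type*} [Field K] [CharZero K] (σ : K →+* K)
    (hσ : ∀ r : K, σ (σ r) = r) :
    (∀ (T : Type*) [AddCommGroup T] [Module K T] (p : T →ₗ[K] T →ₛₗ[σ] T →ₗ[K] T),
      IsGeneralizedJordan p → IsKSimple p → p ≠ 0 → IsAntisymmFirstThird p →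
        ¬ FiniteDimensional K (Kantor.LieAlg p)) ∧
    (∀ c : K, c ≠ 0 → σ c = c →
      IsGeneralizedJordan (blgProduct σ c) ∧ IsKSimple (blgProduct σ c) ∧
        IsAntisymmFirstThird (blgProduct σ c) ∧
        ¬ FiniteDimensional K (Kantor.LieAlg (blgProduct σ c))) :=
  ⟨fun _ _ _ _ hp hs h0 hA => Kantor.not_finiteDimensional_lieAlg hp hs h0 hA, fun _ hc hσc =>
    ⟨blgProduct_isGeneralizedJordan hσ hσc, blgProduct_isKSimple hc,
      blgProduct_isAntisymmFirstThird,
      Kantor.not_finiteDimensional_lieAlg (blgProduct_isGeneralizedJordan hσ hσc)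
        (blgProduct_isKSimple hc) (blgProduct_ne_zero hc) blgProduct_isAntisymmFirstThird⟩⟩
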